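/- Setting. Let $G=(V,E)$ be a finite undirected graph with $m=|E|$ edges and edge capacities $c(e)$ such that $C:=\min_e c(e)>1$. Let $N$ be a finite, linearly ordered set of firms (the bidders) with demands $d(i)\in[0,1]$. Let $\mathcal S_i$ be the family of edge sets with which firm $i$ can be served: in unicast routing, the $s_i$–$t_i$ paths of $G$; in multicast routing, the Steiner trees of $G$, i.e. the subtrees containing all terminals of $i$ (a set of vertices, one of which is the source). A set $R\subseteq N$ of firms is feasible if one can choose $S_i\in\mathcal S_i$ for all $i\in R$ such that $\sum_{i\in R:\,e\in S_i}d(i)\le c(e)$ for all $e\in E$. In the network bandwidth reallocation problem, the firms report bids $b_i\ge 0$ for keeping their access rights, and a set $A$ of firms is to be bought out such that $N\setminus A$ is feasible, with the aim of maximizing the welfare $\sum_{i\in N\setminus A}b_i$. Each firm has a private value $v_i\in[0,\bar v_i]$ and bids in a finite set $B_i$ of nonnegative reals with $\max B_i>\bar v_i$; its truthful bid is $v_i^+=\min\{x\in B_i: x>v_i\}$; its payoff is payment minus $v_i$ if it is bought out (wins), and $0$ otherwise. Selection of connections. For positive edge weights $y$ and each $i$ with $\mathcal S_i\neq\emptyset$,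 let $S_i(y)\in\mathcal S_i$ be a connection (a fixed function of $i$ and $y$) with $\sum_{e\in S_i(y)}y(e)\le\gamma\min_{S\in\mathcal S_i}\sum_{e\in S}y(e)$. In unicast routing $\gamma=1$, so $S_i(y)$ is a shortest path; in multicast routing $\gamma=1.55$, so $S_i(y)$ is a $1.55$-approximate minimum weight Steiner tree. Scoring functions. Put $K=\bar e^{\,C-1}m$, where $\bar e$ is Euler's number. For edge weights $y$ and a firm $i$ bidding $x$, the score is $$\frac{x}{d(i)\sum_{e\in S_i(y)}y(e)}\quad\text{if }\sum_e c(e)y(e)<K\text{ and }\mathcal S_i\ne\emptyset,\qquad\text{and } 0\text{ otherwise}$$ (for a zero denominator, the quotient is $\infty$ if $x>0$ and $0$ if $x=0$). The primal-dual greedy algorithm starts with $y(e)=1/c(e)$ and, while some remaining firm has a positive score, selects and removes a remaining firm $i$ of highest score (the lowest indexed one in case of a tie) and replaces $y(e)$ by $y(e)\,K^{d(i)/(c(e)-1)}$ for all $e\in S_i(y)$. For $A\subseteq N$ let $y^{N\setminus A}$ be the final weights when this algorithm is run on the firms of $N\setminus A$ with their bids. The score $s_i^A(b_i,b_{N\setminus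 A})$ is the score of firm $i$ with bid $b_i$ at $y^{N\setminus A}$. DA auction. Start with $A=N$; while some $i\in A$ has $s_i^A(b_i,b_{N\setminus A})>0$, remove from $A$ the firm with the highest score (the lowest indexed one in case of a tie). The final set $a(b)=A$ is the set of winners. A winner $i$ is paid $\max\{x\in B_i: i\in a(x,b_{-i})\}$; the other firms are paid $0$. Statement. In unicast routing (with $\gamma=1$) and in multicast routing (with $\gamma=1.55$), for every selection of connections as above: (1) The DA auction is weakly group strategy-proof: for all values $v_i\in[0,\bar v_i]$, every nonempty $S\subseteq N$ and all bids $b_i\in B_i$ ($i\in N$), there is a member of $S$ whose payoff under $b$ is at most its payoff when all members of $S$ bid truthfully instead and the bids of the firms outside $S$ are unchanged. (2) The DA auction is $\left(\frac{\bar e\,\gamma\,C}{C-1}\,m^{1/(C-1)}\right)^{-1}$-approximate: for all bids $b\ge0$, the set $N\setminus a(b)$ is feasible, and for every feasible $R\subseteq N$, $$\sum_{i\in N\setminus a(b)}b_i\ \ge\ \left(\frac{\bar e\,\gamma\,C}{C-1}\,m^{1/(C-1)}\right)^{-1}\sum_{i\in R}b_i .$$ -/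

import Mathlib

open scoped ENNReal

noncomputable section

namespace DAAuction

/-! ### Procurement auctions and deferred acceptance -/

section Auctions

variable {N : Type*} [Fintype N] [LinearOrder N]

theorem maximizers_nonempty (f : N → ℝ≥0∞) {A : Finset N} (hA : A.Nonempty) :
    (A.filter fun i => ∀ j ∈ A, f j ≤ f i).Nonempty := by
  obtain ⟨i, hi, h⟩ := A.exists_max_image f hA
  exact ⟨i, Finset.mem_filter.2 ⟨hi, h⟩⟩

/-- `argmax_{i ∈ A} f i`; ties are broken in favour of the lowest index. -/
def argmax (f : N → ℝ≥0∞) (A : Finset N) (hA : A.Nonempty) : N :=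
  (A.filter fun i => ∀ j ∈ A, f j ≤ f i).min' (maximizers_nonempty f hA)

theorem argmax_mem (f : N → ℝ≥0∞) (A : Finset N) (hA : A.Nonempty) : argmax f A hA ∈ A :=
  (Finset.mem_filter.1 (Finset.min'_mem _ (maximizers_nonempty f hA))).1

/-- A family of scoring functions `s^A_i (b_i, b_{N \ A})`, nondecreasing in the own bid `b_i`.
The score depends on the own bid and on the bids of the bidders outside of `A` only. -/
structure Scoring (N : Type*) where
  score : (A : Finset N) → N → ℝ → ({j : N // j ∉ A} → ℝ) → ℝ≥0∞
  mono : ∀ A i (b : {j : N // j ∉ A} → ℝ), Monotone fun x => score A i x b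

/-- The score of bidder `i` at the active set `A` under the bid profile `b`. -/
def Scoring.eval (s : Scoring N) (b : N → ℝ) (A : Finset N) (i : N) : ℝ≥0∞ :=
  s.score A i (b i) fun j => b j

open Classical in
/-- The loop of the DA auction, started at the active set `A`: while some active bidder has a
positive score, reject the highest scoring active bidder. -/
def Scoring.loop (s : Scoring N) (b : N → ℝ) (A : Finset N) : Finset N :=
  if h : ∃ i ∈ A, 0 < s.eval b A i then
    Scoring.loop s b (A.erase (argmax (s.eval b A) A ⟨h.choose, h.choose_spec.1⟩))
  else A
termination_by A.card
decreasing_by exact Finset.card_erase_lt_of_mem (argmax_mem _ _ _)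

/-- Allocation rule of the DA auction: the set of winning bidders. -/
def Scoring.alloc (s : Scoring N) (b : N → ℝ) : Finset N := s.loop b Finset.univ

/-- Payment rule of the DA auction with bid spaces `B`: a winner is paid the largest bid with
which he still wins, a loser is paid nothing. -/
def Scoring.payment (s : Scoring N) (B : N → Finset ℝ) (b : N → ℝ) (i : N) : ℝ :=
  if i ∈ s.alloc b then sSup {x : ℝ | x ∈ B i ∧ i ∈ s.alloc (Function.update b i x)} else 0

/-- Payoff of bidder `i` with value `v i` under the bid profile `b`, in the auction with
allocation rule `a` and payment rule `p`. -/
def payoff (a : (N → ℝ) → Finset N) (p : (N → ℝ) → N → ℝ) (v b : N → ℝ) (i : N) : ℝ :=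
  if i ∈ a b then p b i - v i else 0

/-- The truthful bid `v⁺ = min {x ∈ B : x > v}`. -/
def truthfulBid (B : N → Finset ℝ) (v : N → ℝ) (i : N) : ℝ := sInf {x : ℝ | x ∈ B i ∧ v i < x}

/-- Weak group strategy-proofness: whatever the values `v` and the nonempty group `S`, if the
members of `S` submit `b_i`, `i ∈ S`, then some member of `S` is not strictly better off than he
would be if all members of `S` reported truthfully. The bids `b_i`, `i ∉ S`, of the
other bidders are arbitrary; in particular they may be truthful. -/
def WeaklyGroupStrategyProof (B : N → Finset ℝ) (vbar : N → ℝ)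
    (a : (N → ℝ) → Finset N) (p : (N → ℝ) → N → ℝ) : Prop :=
  ∀ v : N → ℝ, (∀ i, v i ∈ Set.Icc 0 (vbar i)) →
  ∀ S : Finset N, S.Nonempty →
  ∀ b : N → ℝ, (∀ i, b i ∈ B i) →
    ∃ i ∈ S, payoff a p v b i ≤ payoff a p v (S.piecewise (truthfulBid B v) b) i

/-- A reallocation auction with allocation rule `a` is `α`-approximate: the bidders that are not
bought out form a feasible set, whose welfare is at least `α` times that of any feasible set. -/
def IsApproximate (feasible : Finset N → Prop) (a : (N → ℝ) → Finset N) (α : ℝ) : Prop :=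
  ∀ b : N → ℝ, (∀ i, 0 ≤ b i) →
    feasible (Finset.univ \ a b) ∧
    ∀ R : Finset N, feasible R → α * ∑ i ∈ R, b i ≤ ∑ i ∈ Finset.univ \ a b, b i

end Auctions

/-! ### Routing problems and the scoring functions of the primal-dual greedy algorithm -/

/-- The data of a routing problem with edges `E` and firms `N`: capacities, demands, and for each
firm the edge sets with which it can be served (paths, or Steiner trees). -/
structure Routing (E N : Type*) where
  cap : E → ℝ
  demand : N → ℝ
  conn : N → Set (Finset E)

namespace Routing

variable {E N : Type*} [Fintype E] [Fintype N] [LinearOrder N]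

/-- The firms in `R` can be served simultaneously by unsplittable flows. -/
def Feasible (P : Routing E N) (R : Finset N) : Prop :=
  ∃ f : N → Finset E, (∀ i ∈ R, f i ∈ P.conn i) ∧
    ∀ e, (∑ i ∈ R, Set.indicator {j : N | e ∈ f j} P.demand i) ≤ P.cap e

/-- `C = min_e c(e)`. -/
def minCap (P : Routing E N) : ℝ := ⨅ e, P.cap e

/-- `ē^(C-1) m`. -/
def threshold (P : Routing E N) : ℝ := Real.exp (P.minCap - 1) * Fintype.card E

/-- `σ` selects, for each firm and all positive edge weights `y`, a connection whose weight is
at most `γ` times the minimum weight of a connection of that firm (if it has a connection).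
For `γ = 1` it is an argmin. -/
def IsApproxSelection (P : Routing E N) (γ : ℝ) (σ : N → (E → ℝ) → Finset E) : Prop :=
  ∀ i, (P.conn i).Nonempty → ∀ y : E → ℝ, (∀ e, 0 < y e) →
    σ i y ∈ P.conn i ∧ ∀ S ∈ P.conn i, ∑ e ∈ σ i y, y e ≤ γ * ∑ e ∈ S, y e

open Classical in
/-- The score `x / (d(i) ∑_{e ∈ S_i} y(e))` of a firm with bid `x`, where `S_i = σ i y`, if
`∑_e c(e) y(e)` is below the threshold and the firm has a connection at all, and `0` otherwise.
A quotient with zero denominator is `∞` for `x > 0` and `0` for `x = 0`. -/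
def dualScore (P : Routing E N) (σ : N → (E → ℝ) → Finset E) (y : E → ℝ) (i : N) (x : ℝ) :
    ℝ≥0∞ :=
  if ∑ e, P.cap e * y e < P.threshold ∧ (P.conn i).Nonempty then
    ENNReal.ofReal x / ENNReal.ofReal (P.demand i * ∑ e ∈ σ i y, y e)
  else 0

open Classical in
/-- The dual variables after the selection of firm `i`. -/
def dualUpdate (P : Routing E N) (σ : N → (E → ℝ) → Finset E) (y : E → ℝ) (i : N) : E → ℝ :=
  fun e => if e ∈ σ i y then y e * P.threshold ^ (P.demand i / (P.cap e - 1)) else y e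

open Classical in
/-- The final dual variables of the greedy algorithm run on the remaining firms `R` from the dual
variables `y`: while some remaining firm has a positive score, the one with the highest score is
selected and the dual variables are updated. -/
def dualLoop (P : Routing E N) (σ : N → (E → ℝ) → Finset E) (b : N → ℝ) (R : Finset N)
    (y : E → ℝ) : E → ℝ :=
  if h : ∃ i ∈ R, 0 < P.dualScore σ y i (b i) then
    let i := argmax (fun j => P.dualScore σ y j (b j)) R ⟨h.choose, h.choose_spec.1⟩
    dualLoop P σ b (R.erase i) (P.dualUpdate σ y i)
  else y
termination_by R.card
decreasing_by exact Finset.card_erase_lt_of_mem (argmax_mem _ _ _)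

/-- The dual variables `y^{N \ A}` associated with the active set `A`: those produced by the
greedy algorithm, started at `y(e) = 1 / c(e)`, on the firms of `N \ A`. They depend on the bids of
these firms only. When `N \ A` is the set of the firms selected so far in a run on all of `N`,
these firms are selected in the same order in the run on `N \ A`. -/
def duals (P : Routing E N) (σ : N → (E → ℝ) → Finset E) (A : Finset N)
    (b : {j : N // j ∉ A} → ℝ) : E → ℝ :=
  P.dualLoop σ (fun j => if h : j ∉ A then b ⟨j, h⟩ else 0) (Finset.univ \ A)
    fun e => 1 / P.cap e

theorem dualScore_mono (P : Routing E N) (σ : N → (E → ℝ) → Finset E) (y : E → ℝ) (i : N) :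
    Monotone (P.dualScore σ y i) := by
  intro x x' h
  unfold dualScore
  split_ifs
  · exact ENNReal.div_le_div_right (ENNReal.ofReal_le_ofReal h) _
  · exact le_rfl

/-- The scoring functions `s^A_i (b_i, b_{N \ A}) = b_i / (d(i) ∑_{e ∈ S_i} y^{N \ A}(e))`. -/
def scoring (P : Routing E N) (σ : N → (E → ℝ) → Finset E) : Scoring N where
  score A i x b := P.dualScore σ (P.duals σ A b) i x
  mono A i b := P.dualScore_mono σ (P.duals σ A b) i

/-- The approximation ratio `(ē γ C / (C - 1) · m^(1 / (C - 1)))⁻¹`. -/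
def ratio (P : Routing E N) (γ : ℝ) : ℝ :=
  (Real.exp 1 * γ * P.minCap / (P.minCap - 1) *
    (Fintype.card E : ℝ) ^ (1 / (P.minCap - 1)))⁻¹

end Routing

/-! ### Unicast and multicast routing in a graph -/

section Network

variable {V N : Type*}

/-- Unicast routing: firm `i` is served by a path from `s i` to `t i`. -/
def unicast (G : SimpleGraph V) (c : G.edgeSet → ℝ) (d : N → ℝ) (s t : N → V) :
    Routing G.edgeSet N where
  cap := c
  demand := d
  conn i := {S | ∃ p : G.Walk (s i) (t i), p.IsPath ∧
    ∀ e : G.edgeSet, e ∈ S ↔ (e : Sym2 V) ∈ p.edges}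

/-- Multicast routing: firm `i` is served by a Steiner tree, a subtree of the graph that contains
all the terminals in `K i`. -/
def multicast (G : SimpleGraph V) (c : G.edgeSet → ℝ) (d : N → ℝ) (K : N → Finset V) :
    Routing G.edgeSet N where
  cap := c
  demand := d
  conn i := {S | ∃ T : G.Subgraph, T.coe.IsTree ∧ (K i : Set V) ⊆ T.verts ∧
    ∀ e : G.edgeSet, e ∈ S ↔ (e : Sym2 V) ∈ T.edgeSet}

end Network

end DAAuction

end

/-!
**Incentives.** This part holds for every family of scoring functions that are nondecreasing in the
own bid. A bidder who wins stays a winner when he lowers his bid to any level, and the run of the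
auction does not change, because in each round the rejected bidder still beats him. The same is
true for a group: if every member of `S` wins and would still win after moving alone to the bid
`x i`, then all of them win, in an identical run, after moving jointly to bids of at most `x i`
(`Scoring.loop_eq_loop_of_mem_loop_update`). If a joint deviation from truthful bidding made every
member of `S` strictly better off, they would all win at prices `p i` no lower than their truthful
bids. Taking `x i = p i`, they would also win when truthful, and each of them would still win at the
bid `p i` against the truthful bids of the others, so that the truthful price is no lower.

**Approximation.** The rejected bidders of the auction are the firms selected by the primal-dual
greedy algorithm on all firms, since the run on the firms selected so far repeats the selections of
the run on all firms (`Routing.Reach.eval_scoring`). The dual variable of an edge encodes its load,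
and the threshold `K` keeps the loads below the capacities (`Routing.Reach.exists_loads`). For the
welfare bound, let `D = ∑ c(e) y(e)` be the dual objective, which starts at `m`. Let `W` be the
welfare selected so far, `O` that of a feasible set, and `β = C (K^(1/(C-1)) - 1)`. When `i` is
selected, `D` grows by at most `β d(i) ∑_{e ∈ S_i} y(e)` (`Routing.sum_cap_mul_dualUpdate_le`),
and by weak duality `d(i) ∑_{e ∈ S_i} y(e) (O - W) ≤ γ b_i D` (`Routing.mul_sum_le_of_isTop`).
Hence `D ≤ m exp (β γ W / (O - W))` at the end of the run, if `W < O`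
(`Routing.Reach.sum_cap_mul_le`). In this case the run was stopped by `D ≥ K = exp (C - 1) m`, and
comparing exponents gives `O ≤ (1 + β γ / (C - 1)) W`, where the factor is at most
`γ C / (C - 1) · K^(1/(C-1))`, the inverse of the ratio. Graphs play no role beyond supplying the
sets of connections.
-/

namespace DAAuction

variable {N : Type*}

/-! ### Maximal scores with ties broken by index -/

/-- `i` is the lowest indexed maximizer of `f` on `A`. -/
def IsTop [LinearOrder N] (f : N → ℝ≥0∞) (A : Finset N) (i : N) : Prop :=
  i ∈ A ∧ ∀ j ∈ A, f j < f i ∨ f j = f i ∧ i ≤ j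

section IsTop

variable [LinearOrder N] {f g : N → ℝ≥0∞} {A A' : Finset N} {i k : N}

theorem IsTop.mem (h : IsTop f A i) : i ∈ A := h.1

theorem IsTop.le (h : IsTop f A i) {j : N} (hj : j ∈ A) : f j ≤ f i := by
  rcases h.2 j hj with h | h
  · exact h.le
  · exact h.1.le

theorem IsTop.unique (h : IsTop f A i) (h' : IsTop f A k) : i = k := by
  rcases h.2 k h'.1 with h1 | h1 <;> rcases h'.2 i h.1 with h2 | h2
  · exact absurd h1 h2.asymm
  · exact absurd h1 (h2.1 ▸ lt_irrefl _)
  · exact absurd h2 (h1.1 ▸ lt_irrefl _)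
  · exact le_antisymm h1.2 h2.2

theorem IsTop.mono (h : IsTop f A i) (hA : A' ⊆ A) (hi : i ∈ A') : IsTop f A' i :=
  ⟨hi, fun j hj => h.2 j (hA hj)⟩

theorem IsTop.congr (h : IsTop f A i) (hfg : ∀ j ∈ A, f j = g j) : IsTop g A i :=
  ⟨h.1, fun j hj => by rw [← hfg j hj, ← hfg i h.1]; exact h.2 j hj⟩

variable [Fintype N]

theorem isTop_argmax (f : N → ℝ≥0∞) (hA : A.Nonempty) : IsTop f A (argmax f A hA) := by
  have h := (Finset.mem_filter.1 (Finset.min'_mem _ (maximizers_nonempty f hA)))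
  refine ⟨argmax_mem f A hA, fun j hj => ?_⟩
  rcases (h.2 j hj).lt_or_eq with h1 | h1
  · exact Or.inl h1
  · refine Or.inr ⟨h1, Finset.min'_le _ _ (Finset.mem_filter.2 ⟨hj, fun l hl => ?_⟩)⟩
    rw [h1]
    exact h.2 l hl

theorem IsTop.argmax_eq (h : IsTop f A i) (hA : A.Nonempty) : argmax f A hA = i :=
  (isTop_argmax f hA).unique h

theorem exists_isTop (f : N → ℝ≥0∞) (h : ∃ i ∈ A, 0 < f i) : ∃ i, IsTop f A i ∧ 0 < f i := by
  obtain ⟨j, hj, hj0⟩ := h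
  have ht := isTop_argmax f ⟨j, hj⟩
  exact ⟨_, ht, hj0.trans_le (ht.le hj)⟩

end IsTop

/-! ### Weak group strategy-proofness of deferred acceptance auctions -/

namespace Scoring

variable (s : Scoring N) {b b' : N → ℝ} {A : Finset N} {i : N}

theorem eval_congr (hi : b i = b' i) (h : ∀ j ∉ A, b j = b' j) : s.eval b A i = s.eval b' A i := by
  have : (fun j : {j : N // j ∉ A} => b j) = fun j : {j : N // j ∉ A} => b' j :=
    funext fun j => h j j.2
  simp only [eval, hi, this]

theorem eval_le_eval (hi : b i ≤ b' i) (h : ∀ j ∉ A, b j = b' j) :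
    s.eval b A i ≤ s.eval b' A i := by
  have : (fun j : {j : N // j ∉ A} => b j) = fun j : {j : N // j ∉ A} => b' j :=
    funext fun j => h j j.2
  simp only [eval, this]
  exact s.mono A i _ hi

variable [Fintype N] [LinearOrder N]

theorem loop_eq_loop_erase (h : IsTop (s.eval b A) A i) (h0 : 0 < s.eval b A i) :
    s.loop b A = s.loop b (A.erase i) := by
  rw [loop, dif_pos ⟨i, h.mem, h0⟩]
  exact congrArg (fun k => s.loop b (A.erase k)) (h.argmax_eq ⟨i, h.mem⟩)

theorem loop_eq_self (h : ∀ i ∈ A, s.eval b A i = 0) : s.loop b A = A := by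
  rw [loop, dif_neg]
  rintro ⟨i, hi, h0⟩
  exact h0.ne' (h i hi)

theorem loop_subset (b : N → ℝ) (A : Finset N) : s.loop b A ⊆ A := by
  induction A using Finset.strongInduction with
  | H A ih =>
    by_cases h : ∃ i ∈ A, 0 < s.eval b A i
    · obtain ⟨i, hi, h0⟩ := exists_isTop _ h
      rw [s.loop_eq_loop_erase hi h0]
      exact (ih _ (Finset.erase_ssubset hi.1)).trans (Finset.erase_subset _ _)
    · push Not at h
      rw [s.loop_eq_self fun i hi => le_antisymm (h i hi) zero_le]

/-- If all members of `S` win and each of them would still win after changing his own bid to `x i`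
alone, then the auction runs identically when all members of `S` simultaneously submit any bids
of at most `x i`: in each round the score of `i ∈ S` at the bid `x i` is beaten by the bidder
that is rejected, who is not a member of `S`. -/
theorem loop_eq_loop_of_mem_loop_update {S : Finset N} {x : N → ℝ} (hoff : ∀ i ∉ S, b' i = b i)
    (hle : ∀ i ∈ S, b' i ≤ x i) (A : Finset N) (hS : S ⊆ s.loop b A)
    (hx : ∀ i ∈ S, i ∈ s.loop (Function.update b i (x i)) A) : s.loop b' A = s.loop b A := by
  induction A using Finset.strongInduction with
  | H A ih =>
    have hSA : S ⊆ A := hS.trans (s.loop_subset b A)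
    have hout : ∀ j ∉ A, b' j = b j := fun j hj => hoff j fun h => hj (hSA h)
    have hupd : ∀ i ∈ S, ∀ j ∉ A, Function.update b i (x i) j = b j := fun i hi j hj =>
      Function.update_of_ne (by rintro rfl; exact hj (hSA hi)) _ _
    have hupd' : ∀ i ∈ S, ∀ j, j ≠ i →
        s.eval (Function.update b i (x i)) A j = s.eval b A j := fun i hi j hj =>
      s.eval_congr (Function.update_of_ne hj _ _) (hupd i hi)
    have hlow : ∀ i ∈ S, s.eval b' A i ≤ s.eval (Function.update b i (x i)) A i := fun i hi =>
      s.eval_le_eval (by simpa using hle i hi) fun j hj => by rw [hout j hj, hupd i hi j hj]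
    have hsame : ∀ i ∉ S, s.eval b' A i = s.eval b A i := fun i hi =>
      s.eval_congr (hoff i hi) hout
    have hne : ∀ i ∈ S, ∀ k, IsTop (s.eval (Function.update b i (x i)) A) A k →
        0 < s.eval (Function.update b i (x i)) A k → k ≠ i := by
      rintro i hi k hk hk0 rfl
      have := hx k hi
      rw [s.loop_eq_loop_erase hk hk0] at this
      exact Finset.notMem_erase _ _ (s.loop_subset _ _ this)
    by_cases h : ∃ i ∈ A, 0 < s.eval b A i
    · obtain ⟨k, hk, hk0⟩ := exists_isTop _ h
      have hbk := s.loop_eq_loop_erase hk hk0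
      have hkS : k ∉ S := fun hkS =>
        Finset.notMem_erase _ _ (s.loop_subset _ _ (hbk ▸ hS hkS))
      have htop : ∀ i ∈ S, IsTop (s.eval (Function.update b i (x i)) A) A k := by
        intro i hi
        have hki : k ≠ i := fun h => hkS (h ▸ hi)
        obtain ⟨l, hl, hl0⟩ := exists_isTop (s.eval (Function.update b i (x i)) A)
          ⟨k, hk.1, by rwa [hupd' i hi k hki]⟩
        have hli := hne i hi l hl hl0
        -- both `k` and `l` differ from `i`, so they are the top of `A.erase i` for equal scores
        have h1 := hk.mono (Finset.erase_subset i A) (Finset.mem_erase.2 ⟨hki, hk.1⟩)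
        have h2 := (hl.mono (Finset.erase_subset i A) (Finset.mem_erase.2 ⟨hli, hl.1⟩)).congr
          fun j hj => hupd' i hi j (Finset.ne_of_mem_erase hj)
        exact (h1.unique h2) ▸ hl
      have hk' : IsTop (s.eval b' A) A k := by
        refine ⟨hk.1, fun j hj => ?_⟩
        rw [hsame k hkS]
        by_cases hjS : j ∈ S
        · have h1 := (htop j hjS).2 j hj
          rw [hupd' j hjS k fun h => hkS (h ▸ hjS)] at h1
          rcases h1 with h1 | h1
          · exact Or.inl ((hlow j hjS).trans_lt h1)
          · exact ((hlow j hjS).trans_eq h1.1).lt_or_eq.imp id fun h => ⟨h, h1.2⟩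
        · rw [hsame j hjS]
          exact hk.2 j hj
      rw [hbk, s.loop_eq_loop_erase hk' (by rwa [hsame k hkS])]
      refine ih _ (Finset.erase_ssubset hk.1) (hbk ▸ hS) fun i hi => ?_
      have hki : k ≠ i := fun h => hkS (h ▸ hi)
      rw [← s.loop_eq_loop_erase (htop i hi) (by rwa [hupd' i hi k hki])]
      exact hx i hi
    · push Not at h
      have h' : ∀ i ∈ A, s.eval b A i = 0 := fun i hi => le_antisymm (h i hi) zero_le
      rw [s.loop_eq_self h', s.loop_eq_self]
      intro i hi
      by_cases hiS : i ∈ S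
      · refine le_antisymm ((hlow i hiS).trans (not_lt.1 fun h0 => ?_)) zero_le
        obtain ⟨k, hk, hk0⟩ := exists_isTop _ ⟨i, hi, h0⟩
        rw [hupd' i hiS k (hne i hiS k hk hk0), h' k hk.1] at hk0
        exact lt_irrefl _ hk0
      · rw [hsame i hiS, h' i hi]

/-- A joint deviation that makes all members of `S` strictly better off makes all of them win with
payments of at least their truthful bids. Then the truthful profile yields the same run, and the
payments cannot be lower. -/
theorem weaklyGroupStrategyProof (B : N → Finset ℝ) (vbar : N → ℝ)
    (hvbar : ∀ i, ∃ x ∈ B i, vbar i < x) :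
    WeaklyGroupStrategyProof B vbar s.alloc (s.payment B) := by
  rintro v hv S ⟨i₀, hi₀⟩ b hb
  by_contra! h
  set t := truthfulBid B v with ht
  set b' := S.piecewise t b with hb'
  have hfin : ∀ (i : N) (q : ℝ → Prop), {x : ℝ | x ∈ B i ∧ q x}.Finite := fun i q =>
    (B i).finite_toSet.subset fun x hx => hx.1
  have htmem : ∀ i, t i ∈ B i ∧ v i < t i := fun i => by
    obtain ⟨x, hx, hvx⟩ := hvbar i
    exact Set.Nonempty.csInf_mem (s := {x : ℝ | x ∈ B i ∧ v i < x})
      ⟨x, hx, (hv i).2.trans_lt hvx⟩ (hfin i _)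
  have htle : ∀ i, ∀ x ∈ B i, v i < x → t i ≤ x := fun i x hx hvx =>
    csInf_le (hfin i _).bddBelow ⟨hx, hvx⟩
  have hpay_le : ∀ (c : N → ℝ) i, i ∈ s.alloc c → ∀ x ∈ B i,
      i ∈ s.alloc (Function.update c i x) → x ≤ s.payment B c i := fun c i hi x hx hw => by
    rw [payment, if_pos hi]
    exact le_csSup (hfin i _).bddAbove ⟨hx, hw⟩
  have hnonneg : ∀ i ∈ S, 0 ≤ payoff s.alloc (s.payment B) v b' i := by
    intro i hi
    unfold payoff
    split_ifs with hw
    · have hbi : Function.update b' i (t i) = b' := by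
        rw [Function.update_eq_self_iff, hb', Finset.piecewise_eq_of_mem _ _ _ hi]
      have := hpay_le b' i hw (t i) (htmem i).1 (by rwa [hbi])
      linarith [(htmem i).2]
    · exact le_rfl
  have hwin : ∀ i ∈ S, i ∈ s.alloc b := by
    intro i hi
    by_contra hw
    have := (hnonneg i hi).trans_lt (h i hi)
    rw [payoff, if_neg hw] at this
    exact lt_irrefl _ this
  have hpay : ∀ i ∈ S, s.payment B b i ∈ B i ∧
      i ∈ s.alloc (Function.update b i (s.payment B b i)) := by
    intro i hi
    have : s.payment B b i = sSup {x : ℝ | x ∈ B i ∧ i ∈ s.alloc (Function.update b i x)} := by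
      rw [payment, if_pos (hwin i hi)]
    rw [this]
    exact Set.Nonempty.csSup_mem (s := {x : ℝ | x ∈ B i ∧ i ∈ s.alloc (Function.update b i x)})
      ⟨b i, hb i, by rw [Function.update_eq_self]; exact hwin i hi⟩ (hfin i _)
  have htpay : ∀ i ∈ S, t i ≤ s.payment B b i := by
    intro i hi
    have := (hnonneg i hi).trans_lt (h i hi)
    rw [payoff, if_pos (hwin i hi)] at this
    exact htle i _ (hpay i hi).1 (by linarith)
  have key : ∀ c : N → ℝ, (∀ i ∉ S, c i = b i) → (∀ i ∈ S, c i ≤ s.payment B b i) →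
      s.alloc c = s.alloc b := fun c h1 h2 =>
    s.loop_eq_loop_of_mem_loop_update h1 h2 Finset.univ hwin fun i hi => (hpay i hi).2
  have hb'S : ∀ i ∈ S, b' i = t i := fun i hi => Finset.piecewise_eq_of_mem _ _ _ hi
  have hb'N : ∀ i ∉ S, b' i = b i := fun i hi => Finset.piecewise_eq_of_notMem _ _ _ hi
  have h1 : i₀ ∈ s.alloc b' := by
    rw [key b' hb'N fun i hi => (hb'S i hi).trans_le (htpay i hi)]
    exact hwin i₀ hi₀
  have h2 : i₀ ∈ s.alloc (Function.update b' i₀ (s.payment B b i₀)) := by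
    rw [key]
    · exact hwin i₀ hi₀
    · intro i hi
      rw [Function.update_of_ne (by rintro rfl; exact hi hi₀), hb'N i hi]
    · intro i hi
      by_cases hii : i = i₀
      · subst hii
        rw [Function.update_self]
      · rw [Function.update_of_ne hii, hb'S i hi]
        exact htpay i hi
  have h3 := hpay_le b' i₀ h1 _ (hpay i₀ hi₀).1 h2
  have h4 := h i₀ hi₀
  rw [payoff, payoff, if_pos h1, if_pos (hwin i₀ hi₀)] at h4
  linarith

end Scoring

/-! ### The run of the primal-dual greedy algorithm -/

namespace Routing

variable {E : Type*}

section Run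

variable [Fintype E] [Fintype N] [LinearOrder N] {P : Routing E N}
  {σ : N → (E → ℝ) → Finset E} {b b' : N → ℝ} {R : Finset N} {y : E → ℝ} {i : N}

theorem dualLoop_eq_dualLoop_erase (h : IsTop (fun j => P.dualScore σ y j (b j)) R i)
    (h0 : 0 < P.dualScore σ y i (b i)) :
    P.dualLoop σ b R y = P.dualLoop σ b (R.erase i) (P.dualUpdate σ y i) := by
  rw [dualLoop, dif_pos ⟨i, h.mem, h0⟩]
  exact congrArg (fun k => P.dualLoop σ b (R.erase k) (P.dualUpdate σ y k))
    (h.argmax_eq ⟨i, h.mem⟩)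

theorem dualLoop_eq_self (h : ∀ i ∈ R, P.dualScore σ y i (b i) = 0) :
    P.dualLoop σ b R y = y := by
  rw [dualLoop, dif_neg]
  rintro ⟨i, hi, h0⟩
  exact h0.ne' (h i hi)

theorem dualLoop_congr (h : ∀ i ∈ R, b i = b' i) (y : E → ℝ) :
    P.dualLoop σ b R y = P.dualLoop σ b' R y := by
  induction R using Finset.strongInduction generalizing y with
  | H R ih =>
    have hs : ∀ i ∈ R, P.dualScore σ y i (b i) = P.dualScore σ y i (b' i) := fun i hi => by
      rw [h i hi]
    by_cases hp : ∃ i ∈ R, 0 < P.dualScore σ y i (b i)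
    · obtain ⟨i, hi, h0⟩ := exists_isTop _ hp
      rw [dualLoop_eq_dualLoop_erase hi h0,
        dualLoop_eq_dualLoop_erase (hi.congr hs) (by rwa [← hs i hi.1])]
      exact ih _ (Finset.erase_ssubset hi.1) (fun j hj => h j (Finset.mem_of_mem_erase hj)) _
    · push Not at hp
      have hz : ∀ i ∈ R, P.dualScore σ y i (b i) = 0 := fun i hi => le_antisymm (hp i hi) zero_le
      rw [dualLoop_eq_self hz, dualLoop_eq_self fun i hi => by rw [← hs i hi, hz i hi]]

/-- `Reach P σ b A y`: the greedy algorithm, run on all firms with the bids `b`, passes through the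
state in which the firms in `A` are unselected and the dual variables are `y`. -/
inductive Reach (P : Routing E N) (σ : N → (E → ℝ) → Finset E) (b : N → ℝ) :
    Finset N → (E → ℝ) → Prop
  | start : Reach P σ b Finset.univ fun e => 1 / P.cap e
  | step {A : Finset N} {y : E → ℝ} {i : N} (h : Reach P σ b A y)
      (hi : IsTop (fun j => P.dualScore σ y j (b j)) A i) (h0 : 0 < P.dualScore σ y i (b i)) :
      Reach P σ b (A.erase i) (P.dualUpdate σ y i)

/-- The run on the firms selected so far, together with some unselected firms `T`, begins with the
same selections as the run on all firms. -/
theorem Reach.dualLoop_eq {A : Finset N} (h : Reach P σ b A y) {T : Finset N} (hT : T ⊆ A) :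
    P.dualLoop σ b (Finset.univ \ A ∪ T) (fun e => 1 / P.cap e) = P.dualLoop σ b T y := by
  induction h generalizing T with
  | start => simp
  | @step A y i h hi h0 ih =>
    have hiT : i ∉ T := fun h => Finset.notMem_erase _ _ (hT h)
    have hsub : insert i T ⊆ A :=
      Finset.insert_subset hi.1 (hT.trans (Finset.erase_subset _ _))
    have h1 : Finset.univ \ A.erase i ∪ T = Finset.univ \ A ∪ insert i T := by
      ext j
      simp only [Finset.mem_union, Finset.mem_sdiff, Finset.mem_univ, true_and, Finset.mem_erase,
        Finset.mem_insert]
      tauto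
    rw [h1, ih hsub, dualLoop_eq_dualLoop_erase (hi.mono hsub (Finset.mem_insert_self _ _)) h0,
      Finset.erase_insert hiT]

theorem Reach.eval_scoring {A : Finset N} (h : Reach P σ b A y) (i : N) :
    (P.scoring σ).eval b A i = P.dualScore σ y i (b i) := by
  have h1 : P.duals σ A (fun j => b j) = y := by
    rw [duals, dualLoop_congr (b' := b)]
    · simpa [dualLoop_eq_self] using h.dualLoop_eq (Finset.empty_subset A)
    · intro j hj
      rw [dif_pos (Finset.mem_sdiff.1 hj).2]
  change P.dualScore σ (P.duals σ A fun j => b j) i (b i) = _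
  rw [h1]

theorem Reach.exists_reach_loop {A : Finset N} (h : Reach P σ b A y) :
    ∃ z, Reach P σ b ((P.scoring σ).loop b A) z ∧
      ∀ i ∈ (P.scoring σ).loop b A, P.dualScore σ z i (b i) = 0 := by
  induction A using Finset.strongInduction generalizing y with
  | H A ih =>
    have he : (P.scoring σ).eval b A = fun i => P.dualScore σ y i (b i) := funext h.eval_scoring
    by_cases hp : ∃ i ∈ A, 0 < P.dualScore σ y i (b i)
    · obtain ⟨i, hi, h0⟩ := exists_isTop _ hp
      rw [(P.scoring σ).loop_eq_loop_erase (by rwa [he]) (by rwa [he])]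
      exact ih _ (Finset.erase_ssubset hi.1) (h.step hi h0)
    · push Not at hp
      have hz : ∀ i ∈ A, P.dualScore σ y i (b i) = 0 := fun i hi => le_antisymm (hp i hi) zero_le
      rw [(P.scoring σ).loop_eq_self (by simpa only [he] using hz)]
      exact ⟨y, h, hz⟩

end Run

/-! ### Estimates for the dual variables -/

theorem minCap_le [Finite E] (P : Routing E N) (e : E) : P.minCap ≤ P.cap e :=
  ciInf_le (Set.finite_range _).bddBelow e

theorem nonempty_of_one_lt_minCap {P : Routing E N} (hC : 1 < P.minCap) : Nonempty E := by
  by_contra h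
  rw [not_nonempty_iff] at h
  rw [minCap, Real.iInf_of_isEmpty] at hC
  exact absurd hC (by norm_num)

/-- Bernoulli's inequality, together with `(C - 1) c ≤ C (c - 1)`. -/
theorem mul_rpow_sub_one_le {C c d K : ℝ} (hC : 1 < C) (hc : C ≤ c) (hd : d ∈ Set.Icc (0 : ℝ) 1)
    (hK : 1 ≤ K) : c * (K ^ (d / (c - 1)) - 1) ≤ d * (C * (K ^ (1 / (C - 1)) - 1)) := by
  have hC1 : 0 < C - 1 := by linarith
  have hc1 : 0 < c - 1 := by linarith
  have hX : 1 ≤ K ^ (1 / (C - 1)) := Real.one_le_rpow hK (by positivity)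
  set X := K ^ (1 / (C - 1)) with hXdef
  set p := d * ((C - 1) / (c - 1)) with hp
  have hp0 : 0 ≤ p := mul_nonneg hd.1 (by positivity)
  have hp1 : p ≤ 1 := mul_le_one₀ hd.2 (by positivity) ((div_le_one hc1).2 (by linarith))
  have hKX : K ^ (d / (c - 1)) = X ^ p := by
    rw [hXdef, ← Real.rpow_mul (by linarith), hp]
    congr 1
    field_simp
  have hB : X ^ p ≤ 1 + p * (X - 1) := by
    have := rpow_one_add_le_one_add_mul_self (s := X - 1) (by linarith) hp0 hp1
    rwa [add_sub_cancel] at this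
  have hcp : c * p ≤ d * C := by
    have : c * ((C - 1) / (c - 1)) ≤ C := by
      rw [← mul_div_assoc, div_le_iff₀ hc1]
      linarith
    calc c * p = d * (c * ((C - 1) / (c - 1))) := by rw [hp]; ring
      _ ≤ d * C := mul_le_mul_of_nonneg_left this hd.1
  calc c * (K ^ (d / (c - 1)) - 1) ≤ c * (p * (X - 1)) := by
        rw [hKX]
        exact mul_le_mul_of_nonneg_left (by linarith) (by linarith)
    _ = c * p * (X - 1) := by ring
    _ ≤ d * C * (X - 1) := mul_le_mul_of_nonneg_right hcp (by linarith)
    _ = d * (C * (X - 1)) := by ring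

section Duals

variable [Fintype E] {P : Routing E N} {σ : N → (E → ℝ) → Finset E} {y : E → ℝ} {i j : N}

theorem one_le_card (hC : 1 < P.minCap) : (1 : ℝ) ≤ Fintype.card E := by
  have := nonempty_of_one_lt_minCap hC
  exact_mod_cast Fintype.card_pos (α := E)

theorem one_lt_threshold (hC : 1 < P.minCap) : 1 < P.threshold :=
  one_lt_mul_of_lt_of_le (Real.one_lt_exp_iff.2 (by linarith)) (one_le_card hC)

theorem threshold_rpow (hC : 1 < P.minCap) : P.threshold ^ (1 / (P.minCap - 1)) =
    Real.exp 1 * (Fintype.card E : ℝ) ^ (1 / (P.minCap - 1)) := by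
  have : P.minCap - 1 ≠ 0 := by linarith
  rw [threshold, Real.mul_rpow (Real.exp_pos _).le (Nat.cast_nonneg _), ← Real.exp_mul,
    mul_one_div_cancel this]

theorem pos_of_dualScore_pos {x : ℝ} (h : 0 < P.dualScore σ y i x) :
    ∑ e, P.cap e * y e < P.threshold ∧ (P.conn i).Nonempty ∧ 0 < x := by
  unfold dualScore at h
  split_ifs at h with h1
  · refine ⟨h1.1, h1.2, ?_⟩
    by_contra! hx
    rw [ENNReal.ofReal_of_nonpos hx, ENNReal.zero_div] at h
    exact lt_irrefl _ h
  · exact absurd h (lt_irrefl _)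

theorem eq_zero_of_dualScore_eq_zero {x : ℝ} (hx : 0 ≤ x) (hy : ∑ e, P.cap e * y e < P.threshold)
    (hi : (P.conn i).Nonempty) (h : P.dualScore σ y i x = 0) : x = 0 := by
  rw [dualScore, if_pos ⟨hy, hi⟩, ENNReal.div_eq_zero_iff] at h
  rcases h with h | h
  · exact le_antisymm (ENNReal.ofReal_eq_zero.1 h) hx
  · exact absurd h ENNReal.ofReal_ne_top

/-- Comparing scores amounts to comparing cross products, as long as the denominator of the
larger score is positive. -/
theorem mul_le_mul_of_dualScore_le {x x' : ℝ} (hy : ∑ e, P.cap e * y e < P.threshold)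
    (hi : (P.conn i).Nonempty) (hj : (P.conn j).Nonempty) (hx : 0 ≤ x)
    (hden : 0 < P.demand i * ∑ e ∈ σ i y, y e) (hden' : 0 ≤ P.demand j * ∑ e ∈ σ j y, y e)
    (h : P.dualScore σ y j x' ≤ P.dualScore σ y i x) :
    x' * (P.demand i * ∑ e ∈ σ i y, y e) ≤ x * (P.demand j * ∑ e ∈ σ j y, y e) := by
  rw [dualScore, dualScore, if_pos ⟨hy, hj⟩, if_pos ⟨hy, hi⟩, ← ENNReal.ofReal_div_of_pos hden]
    at h
  rcases hden'.eq_or_lt with h0 | h0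
  · rw [← h0, ENNReal.ofReal_zero] at h
    rw [← h0, mul_zero]
    refine mul_nonpos_of_nonpos_of_nonneg ?_ hden.le
    by_contra! hx'
    rw [ENNReal.div_zero (ENNReal.ofReal_pos.2 hx').ne', top_le_iff] at h
    exact ENNReal.ofReal_ne_top h
  · rw [← ENNReal.ofReal_div_of_pos h0, ENNReal.ofReal_le_ofReal_iff (by positivity),
      div_le_div_iff₀ h0 hden] at h
    exact h

theorem dualUpdate_pos (hC : 1 < P.minCap) (hy : ∀ e, 0 < y e) (i : N) (e : E) :
    0 < P.dualUpdate σ y i e := by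
  have := zero_lt_one.trans (one_lt_threshold hC)
  have := hy e
  unfold dualUpdate
  split_ifs <;> positivity

theorem sum_cap_mul_dualUpdate_le (hC : 1 < P.minCap) (hd : P.demand i ∈ Set.Icc (0 : ℝ) 1)
    (hy : ∀ e, 0 < y e) :
    ∑ e, P.cap e * P.dualUpdate σ y i e ≤ ∑ e, P.cap e * y e +
      P.minCap * (P.threshold ^ (1 / (P.minCap - 1)) - 1) *
        (P.demand i * ∑ e ∈ σ i y, y e) := by
  classical
  set β := P.minCap * (P.threshold ^ (1 / (P.minCap - 1)) - 1)
  have h1 : ∑ e ∈ σ i y, y e = ∑ e, if e ∈ σ i y then y e else 0 := by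
    rw [← Finset.sum_filter, Finset.filter_mem_eq_inter, Finset.univ_inter]
  rw [h1, Finset.mul_sum, Finset.mul_sum, ← Finset.sum_add_distrib]
  refine Finset.sum_le_sum fun e _ => ?_
  unfold dualUpdate
  split_ifs with he
  · have := mul_le_mul_of_nonneg_left
      (mul_rpow_sub_one_le hC (P.minCap_le e) hd (one_lt_threshold hC).le) (hy e).le
    linear_combination this
  · simp

end Duals

/-! ### Feasibility and welfare of the selected set -/

section Greedy

variable [Fintype E] [LinearOrder N] {P : Routing E N}
  {σ : N → (E → ℝ) → Finset E} {b : N → ℝ} {A : Finset N} {y : E → ℝ} {γ : ℝ}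

/-- Weak linear programming duality: when `i` is selected, the current dual variables, scaled by
the score of `i`, cover the unselected part of any feasible set `R`. -/
theorem mul_sum_le_of_isTop {i : N} {R : Finset N} (hC : 1 < P.minCap)
    (hd : ∀ i, P.demand i ∈ Set.Icc (0 : ℝ) 1) (hγ : 0 ≤ γ) (hσ : P.IsApproxSelection γ σ)
    (hb : ∀ i, 0 ≤ b i) (hy : ∀ e, 0 < y e)
    (hi : IsTop (fun j => P.dualScore σ y j (b j)) A i) (h0 : 0 < P.dualScore σ y i (b i))
    (hR : P.Feasible R) :
    (P.demand i * ∑ e ∈ σ i y, y e) * ∑ j ∈ R ∩ A, b j ≤ γ * b i * ∑ e, P.cap e * y e := by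
  classical
  obtain ⟨hyK, hconn, -⟩ := pos_of_dualScore_pos h0
  obtain ⟨f, hf, hfe⟩ := hR
  have hnn : ∀ j, 0 ≤ P.demand j * ∑ e ∈ σ j y, y e := fun j =>
    mul_nonneg (hd j).1 (Finset.sum_nonneg fun e _ => (hy e).le)
  have hD : 0 ≤ ∑ e, P.cap e * y e :=
    Finset.sum_nonneg fun e _ => mul_nonneg (by linarith [P.minCap_le e]) (hy e).le
  rcases (hnn i).eq_or_lt with hz | hpos
  · rw [← hz, zero_mul]
    exact mul_nonneg (mul_nonneg hγ (hb i)) hD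
  have hstep : ∀ j ∈ R ∩ A, (P.demand i * ∑ e ∈ σ i y, y e) * b j ≤
      γ * b i * (P.demand j * ∑ e ∈ f j, y e) := by
    intro j hj
    have hjR := (Finset.mem_inter.1 hj).1
    have hjc : (P.conn j).Nonempty := ⟨_, hf j hjR⟩
    have h1 := mul_le_mul_of_dualScore_le hyK hconn hjc (hb i) hpos (hnn j)
      (hi.le (Finset.mem_inter.1 hj).2)
    have h2 := mul_le_mul_of_nonneg_left ((hσ j hjc y hy).2 _ (hf j hjR))
      (mul_nonneg (hb i) (hd j).1)
    linear_combination h1 + h2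
  have hload : ∑ j ∈ R, P.demand j * ∑ e ∈ f j, y e ≤ ∑ e, P.cap e * y e := by
    have : ∀ j, P.demand j * ∑ e ∈ f j, y e =
        ∑ e, Set.indicator {j : N | e ∈ f j} P.demand j * y e := by
      intro j
      simp only [Set.indicator, Set.mem_ofPred_eq, ite_mul, zero_mul]
      rw [← Finset.sum_filter, Finset.filter_mem_eq_inter, Finset.univ_inter, Finset.mul_sum]
    simp only [this]
    rw [Finset.sum_comm]
    refine Finset.sum_le_sum fun e _ => ?_
    rw [← Finset.sum_mul]
    exact mul_le_mul_of_nonneg_right (hfe e) (hy e).le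
  calc (P.demand i * ∑ e ∈ σ i y, y e) * ∑ j ∈ R ∩ A, b j
      ≤ ∑ j ∈ R ∩ A, γ * b i * (P.demand j * ∑ e ∈ f j, y e) := by
        rw [Finset.mul_sum]
        exact Finset.sum_le_sum hstep
    _ = γ * b i * ∑ j ∈ R ∩ A, P.demand j * ∑ e ∈ f j, y e := by rw [Finset.mul_sum]
    _ ≤ γ * b i * ∑ j ∈ R, P.demand j * ∑ e ∈ f j, y e :=
        mul_le_mul_of_nonneg_left (Finset.sum_le_sum_of_subset_of_nonneg Finset.inter_subset_left
          fun j _ _ => mul_nonneg (hd j).1 (Finset.sum_nonneg fun e _ => (hy e).le))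
          (mul_nonneg hγ (hb i))
    _ ≤ γ * b i * ∑ e, P.cap e * y e := mul_le_mul_of_nonneg_left hload (mul_nonneg hγ (hb i))

variable [Fintype N]

theorem univ_sdiff_erase (A : Finset N) (i : N) :
    Finset.univ \ A.erase i = insert i (Finset.univ \ A) := by
  ext j
  simp only [Finset.mem_sdiff, Finset.mem_univ, true_and, Finset.mem_erase, Finset.mem_insert]
  by_cases h : j = i <;> simp [h]

theorem Reach.dual_pos (hC : 1 < P.minCap) (h : Reach P σ b A y) (e : E) : 0 < y e := by
  induction h generalizing e with
  | start => exact one_div_pos.2 (by linarith [P.minCap_le e])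
  | step _ _ _ ih => exact dualUpdate_pos hC ih _ e

/-- The dual variable of an edge records the load `ℓ` of the edge as `y(e) = K^(ℓ / (c - 1)) / c`.
When a firm is selected, `c(e) y(e) < K`, so that the load is below `c(e) - 1`; hence a demand of
at most `1` can be added. -/
theorem Reach.exists_loads (hC : 1 < P.minCap) (hd : ∀ i, P.demand i ∈ Set.Icc (0 : ℝ) 1)
    (hσ : P.IsApproxSelection γ σ) (h : Reach P σ b A y) :
    ∃ f : N → Finset E, (∀ i ∈ Finset.univ \ A, f i ∈ P.conn i) ∧ ∀ e,
      y e = 1 / P.cap e * P.threshold ^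
        ((∑ i ∈ Finset.univ \ A, Set.indicator {j : N | e ∈ f j} P.demand i) / (P.cap e - 1)) ∧
      ∑ i ∈ Finset.univ \ A, Set.indicator {j : N | e ∈ f j} P.demand i ≤ P.cap e := by
  have hK := one_lt_threshold hC
  induction h with
  | start =>
    refine ⟨fun _ => ∅, by simp, fun e => ⟨by simp, ?_⟩⟩
    simpa using by linarith [P.minCap_le e]
  | @step A y i h hi h0 ih =>
    obtain ⟨f, hf, hfe⟩ := ih
    obtain ⟨hyK, hconn, -⟩ := pos_of_dualScore_pos h0
    have hypos := h.dual_pos hC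
    have hiA : i ∉ Finset.univ \ A := fun hiA => (Finset.mem_sdiff.1 hiA).2 hi.1
    refine ⟨Function.update f i (σ i y), ?_, fun e => ?_⟩
    · intro j hj
      by_cases hji : j = i
      · subst hji
        rw [Function.update_self]
        exact (hσ j hconn y hypos).1
      · rw [Function.update_of_ne hji]
        refine hf j ?_
        rw [univ_sdiff_erase] at hj
        exact (Finset.mem_insert.1 hj).resolve_left hji
    · set ℓ := ∑ j ∈ Finset.univ \ A, Set.indicator {j : N | e ∈ f j} P.demand j with hℓ
      have hsum : ∑ j ∈ Finset.univ \ A.erase i,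
          Set.indicator {j : N | e ∈ Function.update f i (σ i y) j} P.demand j =
          Set.indicator {_j : N | e ∈ σ i y} P.demand i + ℓ := by
        rw [univ_sdiff_erase, Finset.sum_insert hiA, hℓ]
        congr 1
        · exact Set.indicator_eq_indicator
            (by rw [Set.mem_ofPred_eq, Set.mem_ofPred_eq, Function.update_self]) rfl
        · refine Finset.sum_congr rfl fun j hj => ?_
          have hji : j ≠ i := fun h => hiA (h ▸ hj)
          exact Set.indicator_eq_indicator
            (by rw [Set.mem_ofPred_eq, Set.mem_ofPred_eq, Function.update_of_ne hji]) rfl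
      have hc : 1 < P.cap e := hC.trans_le (P.minCap_le e)
      obtain ⟨hye, hle⟩ := hfe e
      rw [hsum]
      unfold dualUpdate
      by_cases he : e ∈ σ i y
      · have h1 : P.cap e * y e < P.threshold :=
          (Finset.single_le_sum (f := fun e => P.cap e * y e)
            (fun e _ => mul_nonneg (by linarith [P.minCap_le e]) (hypos e).le)
            (Finset.mem_univ e)).trans_lt hyK
        have h2 : P.threshold ^ (ℓ / (P.cap e - 1)) < P.threshold ^ (1 : ℝ) := by
          rw [Real.rpow_one]
          rwa [hye, ← mul_assoc, mul_one_div_cancel (by linarith), one_mul] at h1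
        rw [Real.rpow_lt_rpow_left_iff hK, div_lt_one (by linarith)] at h2
        have h3 : Set.indicator {_j : N | e ∈ σ i y} P.demand i = P.demand i :=
          Set.indicator_of_mem (s := {_j : N | e ∈ σ i y}) he _
        rw [h3, if_pos he, hye, mul_assoc, ← Real.rpow_add (by linarith), ← add_div,
          add_comm ℓ]
        exact ⟨rfl, by linarith [(hd i).2]⟩
      · have h3 : Set.indicator {_j : N | e ∈ σ i y} P.demand i = 0 :=
          Set.indicator_of_notMem (s := {_j : N | e ∈ σ i y}) he _
        rw [h3, if_neg he, zero_add]
        exact ⟨hye, hle⟩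

/-- As long as the welfare of the selected firms falls short of that of a feasible set `R` by at
least `Q`, the dual objective grows at most exponentially in the welfare of the selected firms. -/
theorem Reach.sum_cap_mul_le {R : Finset N} (hC : 1 < P.minCap)
    (hd : ∀ i, P.demand i ∈ Set.Icc (0 : ℝ) 1) (hγ : 0 ≤ γ) (hσ : P.IsApproxSelection γ σ)
    (hb : ∀ i, 0 ≤ b i) (hR : P.Feasible R) {Q : ℝ} (hQ : 0 < Q) (h : Reach P σ b A y)
    (hQle : Q ≤ ∑ i ∈ R, b i - ∑ i ∈ Finset.univ \ A, b i) :
    ∑ e, P.cap e * y e ≤ Fintype.card E * Real.exp (P.minCap *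
      (P.threshold ^ (1 / (P.minCap - 1)) - 1) * γ * (∑ i ∈ Finset.univ \ A, b i) / Q) := by
  set β := P.minCap * (P.threshold ^ (1 / (P.minCap - 1)) - 1) with hβ
  have hβ0 : 0 ≤ β := mul_nonneg (by linarith) (sub_nonneg.2
    (Real.one_le_rpow (one_lt_threshold hC).le (one_div_nonneg.2 (by linarith))))
  induction h with
  | start =>
    have : ∀ e, P.cap e * (1 / P.cap e) = 1 := fun e =>
      mul_one_div_cancel (by linarith [P.minCap_le e])
    simp only [this]
    simp
  | @step A y i h hi h0 ih =>
    have hypos := h.dual_pos hC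
    have hiA : i ∉ Finset.univ \ A := fun hiA => (Finset.mem_sdiff.1 hiA).2 hi.1
    rw [univ_sdiff_erase, Finset.sum_insert hiA] at hQle ⊢
    set W := ∑ i ∈ Finset.univ \ A, b i with hW
    set D := ∑ e, P.cap e * y e with hDdef
    set L := P.demand i * ∑ e ∈ σ i y, y e with hL
    have hD0 : 0 ≤ D :=
      Finset.sum_nonneg fun e _ => mul_nonneg (by linarith [P.minCap_le e]) (hypos e).le
    have hL0 : 0 ≤ L := mul_nonneg (hd i).1 (Finset.sum_nonneg fun e _ => (hypos e).le)
    have hgap : Q ≤ ∑ j ∈ R ∩ A, b j := by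
      have h1 := Finset.sum_inter_add_sum_sdiff R A b
      have h2 : ∑ j ∈ R \ A, b j ≤ W :=
        Finset.sum_le_sum_of_subset_of_nonneg
          (Finset.sdiff_subset_sdiff (Finset.subset_univ R) le_rfl) fun j _ _ => hb j
      linarith [hb i]
    have hLQ : L ≤ γ * b i * D / Q := by
      rw [le_div_iff₀ hQ]
      exact (mul_le_mul_of_nonneg_left hgap hL0).trans
        (mul_sum_le_of_isTop hC hd hγ hσ hb hypos hi h0 hR)
    calc ∑ e, P.cap e * P.dualUpdate σ y i e ≤ D + β * L :=
          sum_cap_mul_dualUpdate_le hC (hd i) hypos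
      _ ≤ D + β * (γ * b i * D / Q) := by gcongr
      _ = D * (β * γ * b i / Q + 1) := by ring
      _ ≤ D * Real.exp (β * γ * b i / Q) := by gcongr; exact Real.add_one_le_exp _
      _ ≤ Fintype.card E * Real.exp (β * γ * W / Q) * Real.exp (β * γ * b i / Q) := by
          gcongr
          exact ih (by linarith [hb i])
      _ = Fintype.card E * Real.exp (β * γ * (b i + W) / Q) := by
          rw [mul_assoc, ← Real.exp_add]
          congr 2
          ring

theorem isApproximate (hC : 1 < P.minCap) (hd : ∀ i, P.demand i ∈ Set.Icc (0 : ℝ) 1)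
    (hγ : 1 ≤ γ) (hσ : P.IsApproxSelection γ σ) :
    IsApproximate P.Feasible (P.scoring σ).alloc (P.ratio γ) := by
  intro b hb
  obtain ⟨y, hy, hend⟩ := (Reach.start (P := P) (σ := σ) (b := b)).exists_reach_loop
  change Reach P σ b ((P.scoring σ).alloc b) y at hy
  change ∀ i ∈ (P.scoring σ).alloc b, _ at hend
  set A := (P.scoring σ).alloc b
  have hC1 : 0 < P.minCap - 1 := by linarith
  refine ⟨?_, fun R hR => ?_⟩
  · obtain ⟨f, hf, hfe⟩ := hy.exists_loads hC hd hσ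
    exact ⟨f, hf, fun e => (hfe e).2⟩
  set W := ∑ i ∈ Finset.univ \ A, b i with hW
  have hW0 : 0 ≤ W := Finset.sum_nonneg fun i _ => hb i
  set X := P.threshold ^ (1 / (P.minCap - 1)) with hX
  have hX1 : 1 ≤ X := Real.one_le_rpow (one_lt_threshold hC).le (one_div_nonneg.2 hC1.le)
  set κ := γ * P.minCap / (P.minCap - 1) with hκ
  have hκ1 : 1 ≤ κ := by
    rw [hκ, one_le_div hC1]
    nlinarith
  have hratio : P.ratio γ = (κ * X)⁻¹ := by
    rw [ratio, hX, threshold_rpow hC, hκ]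
    congr 1
    ring
  have hκX : 1 ≤ κ * X := one_le_mul_of_one_le_of_one_le hκ1 hX1
  rw [hratio, inv_mul_le_iff₀ (by linarith)]
  rcases le_or_gt (∑ i ∈ R, b i) W with hle | hgt
  · exact hle.trans (le_mul_of_one_le_left hW0 hκX)
  -- the welfare of the selected set is too small, so the threshold must have been reached
  have hK : P.threshold ≤ ∑ e, P.cap e * y e := by
    by_contra! hlt
    obtain ⟨f, hf, -⟩ := hR
    have hz : ∀ i ∈ R ∩ A, b i = 0 := fun i hi =>
      eq_zero_of_dualScore_eq_zero (hb i) hlt ⟨_, hf i (Finset.mem_inter.1 hi).1⟩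
        (hend i (Finset.mem_inter.1 hi).2)
    have h1 := Finset.sum_inter_add_sum_sdiff R A b
    have h2 : ∑ j ∈ R \ A, b j ≤ W :=
      Finset.sum_le_sum_of_subset_of_nonneg
        (Finset.sdiff_subset_sdiff (Finset.subset_univ R) le_rfl) fun j _ _ => hb j
    rw [Finset.sum_eq_zero hz] at h1
    linarith
  have hQ : 0 < ∑ i ∈ R, b i - W := by linarith
  have hgrow := hK.trans (hy.sum_cap_mul_le hC hd (by linarith) hσ hb hR hQ le_rfl)
  rw [← hX, ← hW, threshold, mul_comm, mul_le_mul_iff_of_pos_left (by linarith [one_le_card hC]),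
    Real.exp_le_exp, le_div_iff₀ hQ] at hgrow
  have h1 : ∑ i ∈ R, b i - W ≤ κ * (X - 1) * W := by
    rw [hκ, div_mul_eq_mul_div, div_mul_eq_mul_div, le_div_iff₀ hC1]
    linear_combination hgrow
  nlinarith

end Greedy

end Routing

end DAAuction

theorem corollary2 {V N : Type*} [Fintype V] [DecidableEq V] [Fintype N] [LinearOrder N]
    (G : SimpleGraph V) [DecidableRel G.Adj]
    (c : G.edgeSet → ℝ) (hC : 1 < ⨅ e, c e)
    (d : N → ℝ) (hd : ∀ i, d i ∈ Set.Icc (0 : ℝ) 1)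
    (B : N → Finset ℝ) (hB : ∀ i, ∀ x ∈ B i, 0 ≤ x)
    (vbar : N → ℝ) (hvbar : ∀ i, ∃ x ∈ B i, vbar i < x) :
    (∀ (s t : N → V) (σ : N → (G.edgeSet → ℝ) → Finset G.edgeSet),
      (DAAuction.unicast G c d s t).IsApproxSelection 1 σ →
        DAAuction.WeaklyGroupStrategyProof B vbar
          ((DAAuction.unicast G c d s t).scoring σ).alloc
          (((DAAuction.unicast G c d s t).scoring σ).payment B) ∧
        DAAuction.IsApproximate (DAAuction.unicast G c d s t).Feasible
          ((DAAuction.unicast G c d s t).scoring σ).alloc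
          ((DAAuction.unicast G c d s t).ratio 1)) ∧
    (∀ (source : N → V) (K : N → Finset V) (_ : ∀ i, source i ∈ K i)
        (σ : N → (G.edgeSet → ℝ) → Finset G.edgeSet),
      (DAAuction.multicast G c d K).IsApproxSelection 1.55 σ →
        DAAuction.WeaklyGroupStrategyProof B vbar
          ((DAAuction.multicast G c d K).scoring σ).alloc
          (((DAAuction.multicast G c d K).scoring σ).payment B) ∧
        DAAuction.IsApproximate (DAAuction.multicast G c d K).Feasible
          ((DAAuction.multicast G c d K).scoring σ).alloc
          ((DAAuction.multicast G c d K).ratio 1.55)) := by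
  refine ⟨fun s t σ hσ => ⟨?_, ?_⟩, fun _ K _ σ hσ => ⟨?_, ?_⟩⟩
  · exact DAAuction.Scoring.weaklyGroupStrategyProof _ B vbar hvbar
  · exact DAAuction.Routing.isApproximate hC hd le_rfl hσ
  · exact DAAuction.Scoring.weaklyGroupStrategyProof _ B vbar hvbar
  · exact DAAuction.Routing.isApproximate hC hd (by norm_num) hσ
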